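/- **Setting.** A quantum game has a finite set of players $i$, each with a Hilbert space $\mathbb{C}^{d_i}$, $d_i\ge 1$; a finite set $\Omega$ of outcomes with positive semidefinite operators $P_\omega$ on $\bigotimes_i\mathbb{C}^{d_i}$ such that $\sum_\omega P_\omega=I$; and payoff observables $U_i:\Omega\to\mathbb{R}$. The density matrices of player $i$ are $\mathcal{X}_i=\{X\in\mathbb{C}^{d_i\times d_i} : X\succeq 0,\ \operatorname{tr}X=1\}$, and the expected payoff of player $i$ at $X=(X_j)_j$ is $$u_i(X)=\sum_{\omega\in\Omega}U_i(\omega)\,\operatorname{tr}\Big(P_\omega\bigotimes_j X_j\Big),$$ which extends multilinearly to Hermitian $X_j$. Let $V_i(X)$ be the gradient of $u_i$ in the variable $X_i$ with respect to the inner product $\langle A,B\rangle=\operatorname{tr}(AB)$ on Hermitian matrices. Each player has a regularizer $h_i(X_i)=\operatorname{tr}\theta_i(X_i)$, where $\theta_i:[0,1]\to\mathbb{R}$ is continuous, twice differentiable on $(0,1]$ with $\inf_{(0,1]}\theta_i''>0$, and $\theta_i(0)=0$. For Hermitian $Y_i$ put $Q_i(Y_i)=\operatorname{argmax}_{X_i\in\mathcal{X}_i}\{\operatorname{tr}(Y_iX_i)-h_i(X_i)\}$.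 Let $\mathcal{Y}=\prod_i\{Y_i\in\mathbb{C}^{d_i\times d_i} : Y_i \text{ Hermitian}\}$ and $\mathcal{Z}=\{Z\in\mathcal{Y} : \operatorname{tr}Z_i=0\text{ for all }i\}$, each with its Lebesgue measure $\operatorname{vol}$, and let $\Pi:\mathcal{Y}\to\mathcal{Z}$, $\Pi(Y)_i=Y_i-\tfrac1{d_i}\operatorname{tr}(Y_i)I$. Consider the FTQL dynamics on $\mathcal{Y}$, $$\dot Y_i=V_i(X),\qquad X_j=Q_j(Y_j)\ \text{ for all } j,\tag{FTQL}$$ and the induced dynamics on the traceless quotient $\mathcal{Z}$, $$\dot Z_i=V_i(X)-\tfrac1{d_i}\operatorname{tr}(V_i(X))\,I,\qquad X_j=Q_j(Z_j)\ \text{ for all } j.\tag{FTQL$_{\mathcal Z}$}$$ **Proposition.** For every quantum game and all such regularizers, (FTQL) and (FTQL$_{\mathcal Z}$) are well-posed: there are unique continuous flows $\psi:\mathbb{R}\times\mathcal{Y}\to\mathcal{Y}$ and $\zeta:\mathbb{R}\times\mathcal{Z}\to\mathcal{Z}$ whose orbits are exactly the solutions on $\mathbb{R}$ of the respective system, and $\zeta_t\circ\Pi=\Pi\circ\psi_t$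 for all $t\in\mathbb{R}$. Moreover, both flows preserve volume: 1. if $U\subseteq\mathcal{Y}$ is open, then $\operatorname{vol}(\psi_t(U))=\operatorname{vol}(U)$ for all $t\ge 0$; 2. if $W\subseteq\mathcal{Z}$ is open, then $\operatorname{vol}(\zeta_t(W))=\operatorname{vol}(W)$ for all $t\ge 0$. -/

import Mathlib

open scoped ComplexOrder

namespace QuantumFTQL

/-! ## Hermitian matrices as a real Euclidean space -/

/-- The real vector space of Hermitian `n × n` complex matrices. -/
def Herm (n : ℕ) : Type :=
  selfAdjoint.submodule ℝ (Matrix (Fin n) (Fin n) ℂ)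

namespace Herm

noncomputable instance (n : ℕ) : AddCommGroup (Herm n) :=
  inferInstanceAs (AddCommGroup (selfAdjoint.submodule ℝ (Matrix (Fin n) (Fin n) ℂ)))

noncomputable instance (n : ℕ) : Module ℝ (Herm n) :=
  inferInstanceAs (Module ℝ (selfAdjoint.submodule ℝ (Matrix (Fin n) (Fin n) ℂ)))

instance (n : ℕ) : Module.Finite ℝ (Herm n) :=
  inferInstanceAs (Module.Finite ℝ (selfAdjoint.submodule ℝ (Matrix (Fin n) (Fin n) ℂ)))

/-- The underlying matrix. -/
def mat {n : ℕ} (A : Herm n) : Matrix (Fin n) (Fin n) ℂ := A.1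

theorem isHermitian {n : ℕ} (A : Herm n) : A.mat.IsHermitian := A.2

/-- A Hermitian matrix, seen as an element of `Herm n`. -/
def ofIsHermitian {n : ℕ} (A : Matrix (Fin n) (Fin n) ℂ) (hA : A.IsHermitian) : Herm n := ⟨A, hA⟩

@[simp] theorem mat_ofIsHermitian {n : ℕ} (A : Matrix (Fin n) (Fin n) ℂ) (hA : A.IsHermitian) :
    (ofIsHermitian A hA).mat = A := rfl

@[simp] theorem mat_add {n : ℕ} (A B : Herm n) : (A + B).mat = A.mat + B.mat := rfl

@[simp] theorem mat_smul {n : ℕ} (r : ℝ) (A : Herm n) : (r • A).mat = r • A.mat := rfl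

@[simp] theorem mat_sub {n : ℕ} (A B : Herm n) : (A - B).mat = A.mat - B.mat := rfl

@[simp] theorem mat_zero {n : ℕ} : (0 : Herm n).mat = 0 := rfl

@[ext] theorem ext {n : ℕ} {A B : Herm n} (h : A.mat = B.mat) : A = B := Subtype.ext h

/-- The trace pairing `tr (A B)` of two Hermitian matrices (a real number). -/
def pairing {n : ℕ} (A B : Herm n) : ℝ := (A.mat * B.mat).trace.re

/-- The (real) trace of a Hermitian matrix. -/
def tr {n : ℕ} (A : Herm n) : ℝ := A.mat.trace.re

theorem pairing_self {n : ℕ} (A : Herm n) :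
    pairing A A = ∑ i, ∑ j, Complex.normSq (A.mat i j) := by
  simp only [pairing, Matrix.trace, Matrix.diag, Matrix.mul_apply, Complex.re_sum]
  refine Finset.sum_congr rfl fun i _ => Finset.sum_congr rfl fun j _ => ?_
  rw [← A.isHermitian.apply j i, Complex.star_def, Complex.mul_conj, Complex.ofReal_re]

/-- The trace (Frobenius) inner product `⟪A, B⟫ = tr (A B)`. -/
noncomputable abbrev innerCore (n : ℕ) : InnerProductSpace.Core ℝ (Herm n) where
  inner := pairing
  conj_inner_symm A B := by simp [pairing, Matrix.trace_mul_comm A.mat]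
  re_inner_nonneg A := by
    change 0 ≤ pairing A A
    rw [pairing_self]
    exact Finset.sum_nonneg fun i _ => Finset.sum_nonneg fun j _ => Complex.normSq_nonneg _
  add_left A B C := by simp [pairing, add_mul]
  smul_left A B r := by simp [pairing]
  definite A h := by
    change pairing A A = 0 at h
    rw [pairing_self] at h
    ext i j
    have h1 := (Finset.sum_eq_zero_iff_of_nonneg fun i _ =>
      Finset.sum_nonneg fun j _ => Complex.normSq_nonneg (A.mat i j)).1 h i (Finset.mem_univ i)
    have h2 := (Finset.sum_eq_zero_iff_of_nonneg fun j _ =>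
      Complex.normSq_nonneg (A.mat i j)).1 h1 j (Finset.mem_univ j)
    simpa using h2

noncomputable instance (n : ℕ) : NormedAddCommGroup (Herm n) :=
  (innerCore n).toNormedAddCommGroup

noncomputable instance (n : ℕ) : InnerProductSpace ℝ (Herm n) :=
  InnerProductSpace.ofCore (innerCore n).toCore

theorem inner_def {n : ℕ} (A B : Herm n) : inner ℝ A B = pairing A B := rfl

instance (n : ℕ) : CompleteSpace (Herm n) := FiniteDimensional.complete ℝ (Herm n)

/-- Lebesgue measure on `Herm n` is the `volume` that Mathlib attaches to a finite-dimensional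
real inner product space with its Borel σ-algebra. -/
noncomputable instance (n : ℕ) : MeasurableSpace (Herm n) := borel _

instance (n : ℕ) : BorelSpace (Herm n) := ⟨rfl⟩

end Herm

/-! ## The traceless quotient of `Herm n` -/

/-- The linear subspace of traceless Hermitian matrices. -/
def tracelessSubmodule (n : ℕ) : Submodule ℝ (Herm n) where
  carrier := {A | A.tr = 0}
  add_mem' {A B} hA hB := by
    simp only [Set.mem_ofPred_eq, Herm.tr, Herm.mat_add, Matrix.trace_add, Complex.add_re] at *
    rw [hA, hB, add_zero]
  zero_mem' := by simp [Herm.tr]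
  smul_mem' r A hA := by
    simp only [Set.mem_ofPred_eq, Herm.tr, Herm.mat_smul, Matrix.trace_smul, Complex.smul_re] at *
    rw [hA, smul_zero]

/-- The space of traceless Hermitian matrices, as a Euclidean space of its own (a separate type,
so that `volume` on it is its own Lebesgue measure and not the restriction of the Lebesgue
measure of `Herm n`, for which it is a null set). -/
def Traceless (n : ℕ) : Type := tracelessSubmodule n

namespace Traceless

noncomputable instance (n : ℕ) : NormedAddCommGroup (Traceless n) :=
  inferInstanceAs (NormedAddCommGroup (tracelessSubmodule n))

noncomputable instance (n : ℕ) : InnerProductSpace ℝ (Traceless n) :=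
  inferInstanceAs (InnerProductSpace ℝ (tracelessSubmodule n))

instance (n : ℕ) : Module.Finite ℝ (Traceless n) :=
  inferInstanceAs (Module.Finite ℝ (tracelessSubmodule n))

noncomputable instance (n : ℕ) : MeasurableSpace (Traceless n) := borel _

instance (n : ℕ) : BorelSpace (Traceless n) := ⟨rfl⟩

/-- A traceless Hermitian matrix, seen as a Hermitian matrix. -/
def toHerm {n : ℕ} (A : Traceless n) : Herm n := A.1

end Traceless

theorem isHermitian_sub_trace {n : ℕ} (A : Herm n) :
    (A.mat - (A.tr / n) • (1 : Matrix (Fin n) (Fin n) ℂ)).IsHermitian := by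
  refine A.isHermitian.sub ?_
  simp [Matrix.IsHermitian, Matrix.conjTranspose_smul]

/-- The projection `Y ↦ Y - (1/n) tr(Y) I` onto traceless matrices. -/
noncomputable def removeTrace {n : ℕ} (A : Herm n) : Traceless n :=
  ⟨Herm.ofIsHermitian (A.mat - (A.tr / n) • (1 : Matrix (Fin n) (Fin n) ℂ))
    (isHermitian_sub_trace A), by
    change Complex.re (Matrix.trace _) = 0
    rcases Nat.eq_zero_or_pos n with rfl | hn
    · simp [Matrix.trace]
    · have : (n : ℝ) ≠ 0 := by positivity
      simp only [Herm.mat_ofIsHermitian, Matrix.trace_sub, Matrix.trace_smul, Matrix.trace_one,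
        Fintype.card_fin, Complex.sub_re, Complex.smul_re, Complex.natCast_re, smul_eq_mul,
        Herm.tr]
      field_simp
      simp⟩

/-! ## Quantum games -/

section Game

variable {ι : Type*} [Fintype ι] [DecidableEq ι] {d : ι → ℕ} {Ω : Type*} [Fintype Ω]

/-- A quantum game with (finite) player set `ι`, in which player `i` has the Hilbert space
`ℂ^(d i)`, and with finite set `Ω` of measurement outcomes. The tensor product of the players'
Hilbert spaces is written in the product basis, i.e. it has coordinates indexed by
`∀ i, Fin (d i)`. The data are a POVM on the tensor product and the payoff observables. -/
structure QuantumGame {ι : Type*} [Fintype ι] [DecidableEq ι] (d : ι → ℕ) (Ω : Type*) [Fintype Ω] where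
  /-- The measurement operator attached to each outcome. -/
  povm : Ω → Matrix (∀ i, Fin (d i)) (∀ i, Fin (d i)) ℂ
  povm_posSemidef : ∀ ω, (povm ω).PosSemidef
  sum_povm : ∑ ω, povm ω = 1
  /-- The payoff to each player of each outcome. -/
  observable : ι → Ω → ℝ

/-- The product ket `ψ₁ ⊗ ⋯ ⊗ ψ_N`. -/
noncomputable def productKet (ψ : ∀ i, EuclideanSpace ℂ (Fin (d i))) : (∀ i, Fin (d i)) → ℂ :=
  fun k => ∏ i, ψ i (k i)

/-- The tensor (Kronecker) product `X₁ ⊗ ⋯ ⊗ X_N` of Hermitian matrices. -/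
noncomputable def productMatrix (X : ∀ i, Herm (d i)) :
    Matrix (∀ i, Fin (d i)) (∀ i, Fin (d i)) ℂ :=
  Matrix.of fun k l => ∏ i, (X i).mat (k i) (l i)

/-- Probability of the outcome `ω` at a profile of pure states (unit vectors). -/
noncomputable def outcomeProb (G : QuantumGame d Ω) (ψ : ∀ i, EuclideanSpace ℂ (Fin (d i)))
    (ω : Ω) : ℝ :=
  (star (productKet ψ) ⬝ᵥ (G.povm ω).mulVec (productKet ψ)).re

/-- Expected payoff of player `i` at a profile of pure states. -/
noncomputable def purePayoff (G : QuantumGame d Ω) (i : ι)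
    (ψ : ∀ i, EuclideanSpace ℂ (Fin (d i))) : ℝ :=
  ∑ ω, outcomeProb G ψ ω * G.observable i ω

/-- Expected payoff of player `i` at a profile of mixed states (Born's rule), extended to all
profiles of Hermitian matrices by multilinearity. `mixedPayoff_eq_sum` shows that it is the
multilinear average of the pure payoffs, for every way to write the density matrices as mixtures
of pure states. -/
noncomputable def mixedPayoff (G : QuantumGame d Ω) (i : ι) (X : ∀ i, Herm (d i)) : ℝ :=
  ∑ ω, (G.povm ω * productMatrix X).trace.re * G.observable i ω

theorem mixedPayoff_eq_sum (G : QuantumGame d Ω) (i : ι) (X : ∀ i, Herm (d i))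
    {A : ι → Type*} [∀ j, Fintype (A j)] (x : ∀ j, A j → ℝ)
    (ψ : ∀ j, A j → EuclideanSpace ℂ (Fin (d j)))
    (hX : ∀ j, (X j).mat = ∑ a, x j a • Matrix.vecMulVec (ψ j a) (star (ψ j a).ofLp)) :
    mixedPayoff G i X =
      ∑ a : ∀ j, A j, (∏ j, x j (a j)) * purePayoff G i (fun j => ψ j (a j)) := by
  have key : productMatrix X = ∑ a : ∀ j, A j, (∏ j, x j (a j)) •
      Matrix.vecMulVec (productKet fun j => ψ j (a j)) (star (productKet fun j => ψ j (a j))) := by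
    ext k l
    simp only [productMatrix, Matrix.of_apply, hX, Matrix.sum_apply, Matrix.smul_apply,
      Matrix.vecMulVec_apply, productKet, Pi.star_apply, star_prod, Finset.prod_univ_sum,
      Fintype.piFinset_univ]
    refine Finset.sum_congr rfl fun a _ => ?_
    simp [Finset.prod_mul_distrib]
  simp only [mixedPayoff, purePayoff, outcomeProb, key, Finset.mul_sum, Matrix.trace_sum,
    Complex.re_sum, Finset.sum_mul]
  rw [Finset.sum_comm]
  refine Finset.sum_congr rfl fun a _ => Finset.sum_congr rfl fun ω _ => ?_
  rw [Matrix.mul_smul, Matrix.trace_smul, Matrix.mul_vecMulVec, Matrix.trace_vecMulVec,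
    dotProduct_comm, Complex.smul_re, smul_eq_mul, mul_assoc]

/-- The individual payoff gradient of player `i`: the gradient, with respect to the trace inner
product, of the payoff of player `i` in the player's own matrix variable. -/
noncomputable def payoffGradient (G : QuantumGame d Ω) (X : ∀ i, Herm (d i))
    (i : ι) : Herm (d i) :=
  gradient (fun H : Herm (d i) => mixedPayoff G i (Function.update X i H)) (X i)

end Game

/-! ## Regularized best responses -/

/-- Density matrices: positive-semidefinite matrices with unit trace. -/
def spectraplex (n : ℕ) : Set (Herm n) := {X | X.mat.PosSemidef ∧ X.mat.trace = 1}

/-- Kernels `θ : [0,1] → ℝ` of regularizers: continuous on `[0,1]`, twice differentiable on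
`(0,1]` with `inf θ'' > 0` there, and normalized by `θ 0 = 0`. Only the values of the function
`θ : ℝ → ℝ` on `[0,1]` matter. -/
structure IsRegularizerKernel (θ : ℝ → ℝ) : Prop where
  continuousOn : ContinuousOn θ (Set.Icc 0 1)
  differentiableOn : DifferentiableOn ℝ θ (Set.Ioc 0 1)
  differentiableOn_deriv : DifferentiableOn ℝ (derivWithin θ (Set.Ioc 0 1)) (Set.Ioc 0 1)
  second_deriv_lower_bound : ∃ c : ℝ, 0 < c ∧
    ∀ x ∈ Set.Ioc (0 : ℝ) 1, c ≤ derivWithin (derivWithin θ (Set.Ioc 0 1)) (Set.Ioc 0 1) x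
  map_zero : θ 0 = 0

/-- The regularizer `h(X) = tr θ(X)`, with `θ(X) = ∑ₖ θ(λₖ) uₖ uₖ†` defined by functional
calculus. -/
noncomputable def regularizer {n : ℕ} (θ : ℝ → ℝ) (X : Herm n) : ℝ :=
  (X.isHermitian.cfc θ).trace.re

/-- The regularized best responses to `Y`: the maximizers of `tr(Y X) - h(X)` over all density
matrices `X`. -/
def regularizedBestResponse {n : ℕ} (θ : ℝ → ℝ) (Y : Herm n) : Set (Herm n) :=
  {X | X ∈ spectraplex n ∧
    ∀ X' ∈ spectraplex n, Y.pairing X' - regularizer θ X' ≤ Y.pairing X - regularizer θ X}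

/-! ## The dynamics -/

section Dynamics

variable {ι : Type*} [Fintype ι] [DecidableEq ι] {d : ι → ℕ} {Ω : Type*} [Fintype Ω]

/-- `Y` is a solution on `ℝ` of the FTQL dynamics
`dYᵢ/dt = Vᵢ(X(t))`, `Xᵢ(t) = Qᵢ(Yᵢ(t))`. -/
def IsFTQLSolution (G : QuantumGame d Ω) (θ : ι → ℝ → ℝ) (Y : ℝ → ∀ i, Herm (d i)) : Prop :=
  ∃ X : ℝ → ∀ i, Herm (d i),
    (∀ t i, X t i ∈ regularizedBestResponse (θ i) (Y t i)) ∧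
    ∀ t, HasDerivAt Y (payoffGradient G (X t)) t

/-- `Z` is a solution on `ℝ` of the FTQL dynamics on traceless matrices
`dZᵢ/dt = Vᵢ(X(t)) - (1/dᵢ) tr(Vᵢ(X(t))) I`, `Xᵢ(t) = Qᵢ(Zᵢ(t))`. -/
def IsTracelessFTQLSolution (G : QuantumGame d Ω) (θ : ι → ℝ → ℝ)
    (Z : ℝ → ∀ i, Traceless (d i)) : Prop :=
  ∃ X : ℝ → ∀ i, Herm (d i),
    (∀ t i, X t i ∈ regularizedBestResponse (θ i) (Z t i).toHerm) ∧
    ∀ t, HasDerivAt Z (fun i => removeTrace (payoffGradient G (X t) i)) t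

/-- `φ` is the flow of a well-posed autonomous system with the given set of solutions: for every
initial condition `y`, the orbit `t ↦ φ t y` is the one and only solution that starts at `y`. -/
def IsFlowOf {E : Type*} [TopologicalSpace E] (φ : Flow ℝ E) (IsSolution : (ℝ → E) → Prop) :
    Prop :=
  ∀ y : ℝ → E, IsSolution y ↔ ∀ t, y t = φ t (y 0)

end Dynamics

end QuantumFTQL

open QuantumFTQL MeasureTheory

open Filter Topology MeasureTheory

/-! Well-posedness comes from strong convexity. The regularizer is strongly convex on density
matrices, so its maximizer exists, is unique, and is a Lipschitz function of `Y`
(`norm_bestResponse_sub_le`). The payoff gradient is polynomial and is only evaluated on the compact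
set of density profiles. Hence the vector field is bounded and Lipschitz, and a global flow follows
from Picard–Lindelöf and Grönwall.

Volume is preserved because a player's payoff is linear in the player's own state. The gradient `Vᵢ`
therefore does not involve `Xᵢ`, and the `i`-th component of the field does not involve `Yᵢ`
(`ftqlField_update`): formally the divergence is zero. The field is only known to be Lipschitz, so
the flow is not differentiated in its initial point. Instead, an Euler step in the single coordinate
`i` is a shear, translating `Yᵢ` by a function of the other coordinates, and preserves volume
exactly by Fubini. Performing these shears for every `i` in turn gives a one-step scheme with
uniform local error `O(h²)`. Its iterates with step `t/n` converge to the time-`t` flow, and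
invariance of integrals of compactly supported functions passes to the limit
(`measurePreserving_flow`).

Adding a multiple of the identity to `Yᵢ` changes the objective by a constant on unit-trace
matrices. So the projection onto traceless profiles intertwines the two fields, and the same
argument applies on the quotient. -/

namespace QuantumFTQL

/-! ### Global flows of bounded Lipschitz vector fields -/

section GlobalFlow

variable {E : Type*} [NormedAddCommGroup E] [NormedSpace ℝ E] {F : E → E} {K M : NNReal}

theorem hasDerivAt_comp_neg_time {y : ℝ → E} (hy : ∀ t, HasDerivAt y (F (y t)) t) (t : ℝ) :
    HasDerivAt (fun s => y (-s)) (-F (y (-t))) t := by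
  simpa [Function.comp_def] using (hy (-t)).scomp t (hasDerivAt_neg t)

/-- Bounded Lipschitz vector fields have global solutions. -/
theorem exists_global_solution [CompleteSpace E] (hF : LipschitzWith K F) (hM : ∀ x, ‖F x‖ ≤ M)
    (x : E) : ∃ y : ℝ → E, y 0 = x ∧ ∀ t, HasDerivAt y (F (y t)) t := by
  have hloc : ∀ n : ℕ, ∃ α : ℝ → E, α 0 = x ∧
      ∀ t ∈ Set.Ioo (-((n : ℝ) + 1)) (n + 1), HasDerivAt α (F (α t)) t := by
    intro n
    have h0 : (0 : ℝ) ∈ Set.Icc (-((n : ℝ) + 1)) (n + 1) := ⟨by linarith, by positivity⟩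
    -- A field of norm at most `M` moves a point by at most `M * (n + 1)` in time `n + 1`, so a ball
    -- of that radius suffices on the whole interval.
    have hPL : IsPicardLindelof (fun _ => F) (tmin := -((n : ℝ) + 1)) (tmax := n + 1) ⟨0, h0⟩ x
        (M * (n + 1)) 0 M K :=
      { lipschitzOnWith := fun _ _ => hF.lipschitzOnWith
        continuousOn := fun _ _ => continuousOn_const
        norm_le := fun _ _ x _ => hM x
        mul_max_le := by simp }
    obtain ⟨α, h1, h2⟩ := hPL.exists_eq_forall_mem_Icc_hasDerivWithinAt₀
    exact ⟨α, h1, fun t ht => (h2 t (Set.Ioo_subset_Icc_self ht)).hasDerivAt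
      (Icc_mem_nhds ht.1 ht.2)⟩
  choose α hα0 hα using hloc
  have hagree : ∀ n m : ℕ, n ≤ m →
      Set.EqOn (α n) (α m) (Set.Ioo (-((n : ℝ) + 1)) (n + 1)) := by
    intro n m hnm
    have hnm' : (n : ℝ) ≤ m := by exact_mod_cast hnm
    refine ODE_solution_unique_of_mem_Ioo (v := fun _ => F) (s := fun _ => Set.univ) (t₀ := 0)
      (K := K) (fun _ _ => hF.lipschitzOnWith) ⟨by linarith, by positivity⟩
      (fun t ht => ⟨hα n t ht, trivial⟩)
      (fun t ht => ⟨hα m t ⟨by linarith [ht.1], by linarith [ht.2]⟩, trivial⟩) ?_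
    rw [hα0, hα0]
  have hmem : ∀ t : ℝ, t ∈ Set.Ioo (-((⌈|t|⌉₊ : ℝ) + 1)) (⌈|t|⌉₊ + 1) := fun t =>
    abs_lt.1 (lt_of_le_of_lt (Nat.le_ceil |t|) (lt_add_one _))
  refine ⟨fun t => α ⌈|t|⌉₊ t, by simp [hα0], fun t => ?_⟩
  -- Times `s` close to `t` satisfy `|s| < |t| + 1`, so only local solutions of index at most
  -- `⌈|t|⌉₊ + 1` occur there; all of them agree with that last one.
  have hev : (fun t => α ⌈|t|⌉₊ t) =ᶠ[𝓝 t] α (⌈|t|⌉₊ + 1) := by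
    filter_upwards [(continuous_abs.tendsto t).eventually_lt_const (lt_add_one |t|)] with s hs
    refine hagree _ _ (Nat.ceil_le.2 ?_) (hmem s)
    push_cast
    linarith [Nat.le_ceil |t|]
  have hval : α ⌈|t|⌉₊ t = α (⌈|t|⌉₊ + 1) t := hagree _ _ (Nat.le_succ _) (hmem t)
  beta_reduce
  rw [hval]
  refine (hα (⌈|t|⌉₊ + 1) t ?_).congr_of_eventuallyEq hev
  have := hmem t
  push_cast
  exact ⟨by linarith [this.1], by linarith [this.2]⟩

theorem dist_solution_le (hF : LipschitzWith K F) {y z : ℝ → E}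
    (hy : ∀ t, HasDerivAt y (F (y t)) t) (hz : ∀ t, HasDerivAt z (F (z t)) t) (t : ℝ) :
    dist (y t) (z t) ≤ dist (y 0) (z 0) * Real.exp (K * |t|) := by
  rcases le_total 0 t with ht | ht
  · have := dist_le_of_trajectories_ODE (v := fun _ => F) (fun _ => hF) (a := 0) (b := t)
      (fun s _ => (hy s).continuousAt.continuousWithinAt) (fun s _ => (hy s).hasDerivWithinAt)
      (fun s _ => (hz s).continuousAt.continuousWithinAt) (fun s _ => (hz s).hasDerivWithinAt)
      le_rfl t ⟨ht, le_rfl⟩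
    simpa [abs_of_nonneg ht] using this
  -- Negative times reduce to positive ones: reversing time gives solutions of `-F`, which has the
  -- same Lipschitz constant.
  · have hy' := hasDerivAt_comp_neg_time hy
    have hz' := hasDerivAt_comp_neg_time hz
    have := dist_le_of_trajectories_ODE (v := fun _ x => -F x) (fun _ => hF.neg) (a := 0) (b := -t)
      (fun s _ => (hy' s).continuousAt.continuousWithinAt) (fun s _ => (hy' s).hasDerivWithinAt)
      (fun s _ => (hz' s).continuousAt.continuousWithinAt) (fun s _ => (hz' s).hasDerivWithinAt)
      le_rfl (-t) ⟨by linarith, le_rfl⟩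
    simpa [abs_of_nonpos ht] using this

theorem solution_unique (hF : LipschitzWith K F) {y z : ℝ → E}
    (hy : ∀ t, HasDerivAt y (F (y t)) t) (hz : ∀ t, HasDerivAt z (F (z t)) t) (h0 : y 0 = z 0) :
    y = z := by
  ext t
  simpa [h0] using dist_solution_le hF hy hz t

/-- A bounded Lipschitz vector field generates a flow. -/
theorem exists_flow [CompleteSpace E] (hF : LipschitzWith K F) (hM : ∀ x, ‖F x‖ ≤ M) :
    ∃ φ : Flow ℝ E, IsFlowOf φ fun y => ∀ t, HasDerivAt y (F (y t)) t := by
  choose Φ hΦ0 hΦ using exists_global_solution hF hM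
  have hcont : Continuous (Function.uncurry fun t x => Φ x t) := by
    rw [continuous_iff_continuousAt]
    rintro ⟨s, x⟩
    rw [ContinuousAt, tendsto_iff_dist_tendsto_zero]
    have hle : ∀ p : ℝ × E, dist (Φ p.2 p.1) (Φ x s) ≤
        dist p.2 x * Real.exp (K * |p.1|) + dist (Φ x p.1) (Φ x s) := fun p => by
      refine (dist_triangle _ (Φ x p.1) _).trans ?_
      gcongr
      simpa [hΦ0] using dist_solution_le hF (hΦ p.2) (hΦ x) p.1
    refine squeeze_zero (fun _ => dist_nonneg) hle ?_
    have hx : Continuous (Φ x) := continuous_iff_continuousAt.2 fun t => (hΦ x t).continuousAt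
    have : Continuous fun p : ℝ × E =>
        dist p.2 x * Real.exp (K * |p.1|) + dist (Φ x p.1) (Φ x s) := by fun_prop
    simpa using this.tendsto (s, x)
  let φ : Flow ℝ E :=
    { toFun := fun t x => Φ x t
      cont' := hcont
      map_add' := fun s t x => by
        refine congrFun (solution_unique hF (y := fun s => Φ x (s + t)) (fun r => ?_)
          (hΦ (Φ x t)) (by simp [hΦ0])) s
        exact (hΦ x (r + t)).comp_add_const r t
      map_zero' := hΦ0 }
  refine ⟨φ, fun y => ⟨fun hy t => congrFun (solution_unique hF hy (hΦ (y 0)) (hΦ0 _).symm) t,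
    fun hy => ?_⟩⟩
  have : y = Φ (y 0) := funext hy
  rw [this]
  exact hΦ _

theorem IsFlowOf.isSolution {X : Type*} [TopologicalSpace X] {φ : Flow ℝ X} {S : (ℝ → X) → Prop}
    (hφ : IsFlowOf φ S) (x : X) : S fun t => φ t x :=
  (hφ _).2 fun t => by simp

theorem IsFlowOf.unique {X : Type*} [TopologicalSpace X] {φ ψ : Flow ℝ X} {S : (ℝ → X) → Prop}
    (hφ : IsFlowOf φ S) (hψ : IsFlowOf ψ S) : φ = ψ := by
  ext t x
  simpa using (hψ _).1 (hφ.isSolution x) t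

end GlobalFlow

/-! ### Error of the coordinatewise Euler scheme -/

section Splitting

theorem lipschitz_list_sum {E ι : Type*} [SeminormedAddCommGroup E] {F : ι → E → E} {K : NNReal} (hF : ∀ i, LipschitzWith K (F i))
    (l : List ι) : LipschitzWith (l.length * K) fun y => (l.map fun i => F i y).sum := by
  induction l with
  | nil => simpa using (LipschitzWith.const (0 : E) : LipschitzWith 0 fun _ : E => (0 : E))
  | cons i l ih =>
    have := (hF i).add ih
    simp only [List.map_cons, List.sum_cons, List.length_cons, Nat.cast_add, Nat.cast_one]
    rwa [add_mul, one_mul, add_comm]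

variable {E : Type*} [NormedAddCommGroup E] [NormedSpace ℝ E] {ι : Type*}

/-- One step of the explicit splitting scheme of a sum of vector fields: the Euler steps of the
summands, one after the other. -/
def splittingStep (F : ι → E → E) (h : ℝ) : List ι → E → E
  | [], y => y
  | i :: l, y => splittingStep F h l (y + h • F i y)

/-- Each summand is evaluated at a point displaced by `O(h)` instead of at `y`. The Lipschitz bound
makes this an `O(h)` change of velocity, hence an `O(h²)` error, with a constant uniform in `y`. -/
theorem splittingStep_sub_le {F : ι → E → E} {K M : NNReal} (hF : ∀ i, LipschitzWith K (F i))
    (hM : ∀ i x, ‖F i x‖ ≤ M) (l : List ι) :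
    ∃ C : ℝ, 0 ≤ C ∧ ∀ h y,
      ‖splittingStep F h l y - (y + h • (l.map fun i => F i y).sum)‖ ≤ C * h ^ 2 := by
  induction l with
  | nil => exact ⟨0, le_rfl, fun h y => by simp [splittingStep]⟩
  | cons i l ih =>
    obtain ⟨C, hC, H⟩ := ih
    refine ⟨C + l.length * K * M, by positivity, fun h y => ?_⟩
    set G : E → E := fun y => (l.map fun i => F i y).sum with hG
    set y' := y + h • F i y with hy'
    have e : splittingStep F h (i :: l) y - (y + h • ((i :: l).map fun i => F i y).sum) =
        (splittingStep F h l y' - (y' + h • G y')) + h • (G y' - G y) := by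
      simp only [splittingStep, List.map_cons, List.sum_cons, hG, hy', smul_add, smul_sub]
      abel
    have h2 : ‖G y' - G y‖ ≤ l.length * K * (|h| * M) := by
      refine ((lipschitz_list_sum hF l).norm_sub_le y' y).trans ?_
      rw [hy', add_sub_cancel_left, norm_smul, Real.norm_eq_abs]
      push_cast
      gcongr
      exact hM i y
    rw [e]
    calc _ ≤ ‖splittingStep F h l y' - (y' + h • G y')‖ + |h| * ‖G y' - G y‖ := by
          simpa [norm_smul] using norm_add_le (splittingStep F h l y' - (y' + h • G y'))
            (h • (G y' - G y))
      _ ≤ C * h ^ 2 + |h| * (l.length * K * (|h| * M)) := by gcongr; exact H h y'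
      _ = (C + l.length * K * M) * h ^ 2 := by rw [← sq_abs h]; ring

/-- Up to time `h` the solution moves by at most `M * h`, so its velocity differs from the initial
one by at most `K * M * h`; integrating over `[0, h]` gives the quadratic bound. -/
theorem norm_solution_sub_euler_le {F : E → E} {K M : NNReal} (hF : LipschitzWith K F)
    (hM : ∀ x, ‖F x‖ ≤ M) {y : ℝ → E} (hy : ∀ t, HasDerivAt y (F (y t)) t) {h : ℝ} (hh : 0 ≤ h) :
    ‖y h - (y 0 + h • F (y 0))‖ ≤ K * M * h ^ 2 := by
  have h1 : ∀ s ∈ Set.Icc 0 h, ‖y s - y 0‖ ≤ M * h := fun s hs => by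
    have := (convex_univ (𝕜 := ℝ) (E := ℝ)).norm_image_sub_le_of_norm_hasDerivWithin_le (f := y)
      (C := M) (fun t _ => (hy t).hasDerivWithinAt) (fun t _ => hM _)
      (Set.mem_univ 0) (Set.mem_univ s)
    refine this.trans ?_
    rw [sub_zero, Real.norm_of_nonneg hs.1]
    exact mul_le_mul_of_nonneg_left hs.2 M.2
  have h2 := (convex_Icc (0 : ℝ) h).norm_image_sub_le_of_norm_hasDerivWithin_le
    (f := fun s => y s - s • F (y 0)) (C := K * (M * h))
    (f' := fun s => F (y s) - F (y 0))
    (fun s _ => by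
      have := (hy s).fun_sub ((hasDerivAt_id s).smul_const (F (y 0)))
      simpa using this.hasDerivWithinAt)
    (fun s hs => (hF.norm_sub_le _ _).trans
      (mul_le_mul_of_nonneg_left (h1 s hs) K.2))
    (Set.left_mem_Icc.2 hh) (Set.right_mem_Icc.2 hh)
  have e : y h - (y 0 + h • F (y 0)) = y h - h • F (y 0) - (y 0 - (0 : ℝ) • F (y 0)) := by
    simp only [zero_smul]; abel
  rw [e]
  refine h2.trans (le_of_eq ?_)
  rw [sub_zero, Real.norm_of_nonneg hh]
  ring

/-- Global error of a one-step method with quadratic local error. -/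
theorem dist_iterate_le {X : Type*} [PseudoMetricSpace X] (φ : Flow ℝ X) {K : NNReal}
    (hφ : ∀ t x y, dist (φ t x) (φ t y) ≤ dist x y * Real.exp (K * |t|))
    {S : X → X} {h ε : ℝ} (hε : 0 ≤ ε) (hh : 0 ≤ h) (hS : ∀ x, dist (φ h x) (S x) ≤ ε)
    (n : ℕ) (x : X) : dist (φ (n * h) x) (S^[n] x) ≤ n * ε * Real.exp (K * (n * h)) := by
  induction n with
  | zero => simp
  | succ n ih =>
    rw [Function.iterate_succ_apply', Nat.cast_add, Nat.cast_one, add_mul, one_mul, add_comm _ h,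
      Flow.map_add]
    have hexp : 1 ≤ Real.exp (K * (h + n * h)) := Real.one_le_exp (by positivity)
    calc dist (φ h (φ (n * h) x)) (S (S^[n] x))
        ≤ dist (φ h (φ (n * h) x)) (φ h (S^[n] x)) + dist (φ h (S^[n] x)) (S (S^[n] x)) :=
          dist_triangle _ _ _
      -- The accumulated error is carried along by the flow, growing by at most `exp (K * h)`, and
      -- one fresh local error is added.
      _ ≤ n * ε * Real.exp (K * (n * h)) * Real.exp (K * h) + ε := by
          refine add_le_add ((hφ _ _ _).trans ?_) (hS _)
          rw [abs_of_nonneg hh]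
          gcongr
      _ = n * ε * Real.exp (K * (h + n * h)) + ε * 1 := by
          rw [mul_assoc, ← Real.exp_add]; ring_nf
      _ ≤ n * ε * Real.exp (K * (h + n * h)) + ε * Real.exp (K * (h + n * h)) := by gcongr
      _ = (n + 1) * ε * Real.exp (K * (h + n * h)) := by ring

end Splitting

/-! ### Volume preservation by shears and limits -/

section VolumePreserving

/-- A homeomorphism that is a pointwise limit, at bounded distance from the identity, of
measure preserving maps is measure preserving. -/
theorem measurePreserving_of_tendsto {X : Type*} [MetricSpace X] [ProperSpace X]
    [MeasurableSpace X] [BorelSpace X] {μ : Measure X} [μ.Regular] {T : ℕ → X → X}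
    (hT : ∀ n, MeasurePreserving (T n) μ μ) {R : ℝ} (hR : ∀ n x, dist (T n x) x ≤ R)
    (Ψ : X ≃ₜ X) (hlim : ∀ x, Tendsto (fun n => T n x) atTop (𝓝 (Ψ x))) :
    MeasurePreserving Ψ μ μ := by
  refine ⟨Ψ.continuous.measurable, ?_⟩
  have : (μ.map Ψ).Regular := Measure.Regular.map Ψ
  -- Regular measures are determined by integrals of compactly supported continuous functions, for
  -- which pointwise convergence of the maps is enough.
  refine Measure.ext_of_integral_eq_on_compactlySupported fun f => ?_
  rw [Ψ.measurableEmbedding.integral_map]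
  have hint : ∀ n, ∫ x, f (T n x) ∂μ = ∫ x, f x ∂μ := fun n => by
    have := integral_map (hT n).measurable.aemeasurable
      (f.continuous.measurable.aestronglyMeasurable (μ := μ.map (T n)))
    rw [(hT n).map_eq] at this
    exact this.symm
  -- Points move by at most `R`, so every `f ∘ T n` vanishes off the `R`-thickening of the support;
  -- this supplies an integrable dominating function.
  have hcomp : IsCompact (Metric.cthickening R (tsupport f)) :=
    f.hasCompactSupport.isCompact.cthickening
  obtain ⟨C, hC⟩ := f.hasCompactSupport.exists_bound_of_continuous f.continuous
  have key : Tendsto (fun n => ∫ x, f (T n x) ∂μ) atTop (𝓝 (∫ x, f (Ψ x) ∂μ)) := by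
    refine tendsto_integral_of_dominated_convergence
      ((Metric.cthickening R (tsupport f)).indicator fun _ => C)
      (fun n => (f.continuous.measurable.comp (hT n).measurable).aestronglyMeasurable)
      ((integrable_indicator_iff hcomp.measurableSet).2
        (integrableOn_const hcomp.measure_lt_top.ne))
      (fun n => Eventually.of_forall fun x => ?_)
      (Eventually.of_forall fun x => (f.continuous.tendsto _).comp (hlim x))
    by_cases hx : x ∈ Metric.cthickening R (tsupport f)
    · rw [Set.indicator_of_mem hx]
      exact hC _
    · rw [Set.indicator_of_notMem hx]
      have : T n x ∉ tsupport f := fun hmem =>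
        hx (Metric.mem_cthickening_of_dist_le x (T n x) R _ hmem (by
          rw [dist_comm]; exact hR n x))
      rw [image_eq_zero_of_notMem_tsupport this, norm_zero]
  simp only [hint] at key
  exact tendsto_nhds_unique key tendsto_const_nhds

variable {ι : Type*} [Fintype ι] [DecidableEq ι] {E : ι → Type*}
  [∀ i, NormedAddCommGroup (E i)] [∀ i, NormedSpace ℝ (E i)] [∀ i, FiniteDimensional ℝ (E i)]
  [∀ i, MeasureSpace (E i)] [∀ i, BorelSpace (E i)]
  [∀ i, (volume : Measure (E i)).IsAddHaarMeasure]

/-- Translating one coordinate by a function of the other coordinates preserves volume. -/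
theorem measurePreserving_add_single {i : ι} {g : (∀ i, E i) → E i} (hg : Measurable g)
    (hgi : ∀ y e, g (Function.update y i e) = g y) :
    MeasurePreserving (fun y => y + Pi.single i (g y)) (volume : Measure (∀ i, E i)) volume := by
  have : ∀ i, ProperSpace (E i) := fun i => FiniteDimensional.proper_real (E i)
  have hmeas : Measurable fun y : ∀ i, E i => y + Pi.single i (g y) :=
    measurable_id.add ((measurable_update' (a := i)).comp (measurable_const.prodMk hg))
  refine ⟨hmeas, Measure.ext_of_lintegral _ fun f hf => ?_⟩
  rw [lintegral_map hf hmeas, volume_pi]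
  -- By Fubini it suffices to integrate over the `i`-th coordinate, where the map is a translation
  -- by the constant `g x`.
  refine lintegral_eq_of_lmarginal_eq {i} (hf.comp hmeas) hf (funext fun x => ?_)
  rw [lmarginal_singleton, lmarginal_singleton]
  have e : ∀ z : E i, f (Function.update x i z + Pi.single i (g (Function.update x i z))) =
      f (Function.update x i (z + g x)) := fun z => by
    congr 1
    ext j
    rcases eq_or_ne j i with rfl | hj
    · simp [hgi]
    · simp [hj]
  simp only [e]
  exact lintegral_add_right_eq_self (fun z => f (Function.update x i z)) (g x)

/-- **Liouville's theorem** for bounded Lipschitz vector fields on a product space in which no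
component depends on its own coordinate. -/
theorem measurePreserving_flow {F : (∀ i, E i) → ∀ i, E i} {K M : NNReal} (hF : LipschitzWith K F)
    (hM : ∀ x, ‖F x‖ ≤ M) (hFi : ∀ i y e, F (Function.update y i e) i = F y i)
    {φ : Flow ℝ (∀ i, E i)} (hφ : IsFlowOf φ fun y => ∀ t, HasDerivAt y (F (y t)) t)
    {t : ℝ} (ht : 0 ≤ t) : MeasurePreserving (φ t) (volume : Measure (∀ i, E i)) volume := by
  have : ∀ i, ProperSpace (E i) := fun i => FiniteDimensional.proper_real (E i)
  set P : ι → (∀ i, E i) → ∀ i, E i := fun i y => Pi.single i (F y i) with hP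
  have hPK : ∀ i, LipschitzWith K (P i) := fun i => by
    refine LipschitzWith.of_dist_le_mul fun x y => ?_
    rw [dist_eq_norm, dist_eq_norm, hP]
    simp only
    rw [← Pi.single_sub, Pi.norm_single]
    exact (norm_le_pi_norm (F x - F y) i).trans (hF.norm_sub_le x y)
  have hPM : ∀ i x, ‖P i x‖ ≤ M := fun i x => by
    rw [hP]
    simp only [Pi.norm_single]
    exact (norm_le_pi_norm (F x) i).trans (hM x)
  set l : List ι := Finset.univ.toList with hl
  have hsum : ∀ y, (l.map fun i => P i y).sum = F y := fun y => by
    rw [hl, Finset.sum_map_toList, hP, Finset.univ_sum_single]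
  obtain ⟨C, hC, hstep⟩ := splittingStep_sub_le hPK hPM l
  simp only [hsum] at hstep
  have hpres : ∀ (h : ℝ) (l : List ι),
      MeasurePreserving (splittingStep P h l) (volume : Measure (∀ i, E i)) volume := by
    intro h l
    induction l with
    | nil => exact MeasurePreserving.id _
    | cons i l ih =>
      refine ih.comp ?_
      have e : (fun y => y + h • P i y) = fun y => y + Pi.single i (h • F y i) := by
        ext y j
        simp [hP, Pi.single_smul]
      rw [e]
      refine measurePreserving_add_single (g := fun y => h • F y i) ?_ fun y e => by rw [hFi]
      exact (((continuous_apply i).comp hF.continuous).const_smul h).measurable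
  have hflow : ∀ t x y, dist (φ t x) (φ t y) ≤ dist x y * Real.exp (K * |t|) := fun t x y => by
    simpa using dist_solution_le hF (hφ.isSolution x) (hφ.isSolution y) t
  have hloc : ∀ h, 0 ≤ h → ∀ y, dist (φ h y) (splittingStep P h l y) ≤ (K * M + C) * h ^ 2 := by
    intro h hh y
    have h1 : dist (φ h y) (y + h • F y) ≤ K * M * h ^ 2 := by
      simpa [dist_eq_norm] using norm_solution_sub_euler_le hF hM (hφ.isSolution y) hh
    have h2 : dist (splittingStep P h l y) (y + h • F y) ≤ C * h ^ 2 := by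
      simpa [dist_eq_norm] using hstep h y
    linarith [dist_triangle_right (φ h y) (splittingStep P h l y) (y + h • F y)]
  set A : ℝ := (K * M + C) * t ^ 2 * Real.exp (K * t) with hA
  have hA0 : 0 ≤ A := by positivity
  -- Using `n + 1` steps avoids division by zero. The total error is of order `(n + 1) * (t / (n +
  -- 1)) ^ 2`.
  set T : ℕ → (∀ i, E i) → ∀ i, E i := fun n => (splittingStep P (t / (n + 1)) l)^[n + 1]
  have hT : ∀ n x, dist (T n x) (φ t x) ≤ A * (1 / ((n : ℝ) + 1)) := fun n x => by
    have hn : ((n + 1 : ℕ) : ℝ) * (t / (n + 1)) = t := by push_cast; field_simp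
    have := dist_iterate_le φ hflow (by positivity) (by positivity : 0 ≤ t / ((n : ℝ) + 1))
      (hloc _ (by positivity)) (n + 1) x
    rw [hn] at this
    rw [dist_comm]
    refine this.trans (le_of_eq ?_)
    rw [hA]
    push_cast
    field_simp
  -- The limiting argument needs a displacement bound for the approximations; it is obtained from
  -- that of the flow plus the approximation error.
  have hmove : ∀ x, dist (φ t x) x ≤ K * M * t ^ 2 + t * M := fun x => by
    have h1 := norm_solution_sub_euler_le hF hM (hφ.isSolution x) ht
    simp only [Flow.map_zero_apply] at h1
    calc dist (φ t x) x = ‖(φ t x - (x + t • F x)) + t • F x‖ := by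
          rw [dist_eq_norm]; congr 1; abel
      _ ≤ ‖φ t x - (x + t • F x)‖ + ‖t • F x‖ := norm_add_le _ _
      _ ≤ K * M * t ^ 2 + t * M := by
          rw [norm_smul, Real.norm_of_nonneg ht]
          gcongr
          exact hM x
  refine measurePreserving_of_tendsto (T := T) (R := A + (K * M * t ^ 2 + t * M))
    (fun n => (hpres _ l).iterate _) (fun n x => ?_) (φ.toHomeomorph t) fun x => ?_
  · refine (dist_triangle _ (φ t x) _).trans (add_le_add ((hT n x).trans ?_) (hmove x))
    refine mul_le_of_le_one_right hA0 ?_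
    rw [div_le_one (by positivity)]
    linarith [n.cast_nonneg (α := ℝ)]
  · rw [tendsto_iff_dist_tendsto_zero]
    refine squeeze_zero (fun _ => dist_nonneg) (fun n => hT n x) ?_
    simpa using (tendsto_one_div_add_atTop_nhds_zero_nat (𝕜 := ℝ)).const_mul A

end VolumePreserving

end QuantumFTQL

namespace QuantumFTQL

/-! ### Diagonal entries in a unitary basis -/

namespace Herm

variable {n : ℕ}

/-- The underlying matrix, as a linear map. -/
def matₗ (n : ℕ) : Herm n →ₗ[ℝ] Matrix (Fin n) (Fin n) ℂ where
  toFun := mat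
  map_add' _ _ := rfl
  map_smul' _ _ := rfl

theorem continuous_mat : Continuous (mat : Herm n → Matrix (Fin n) (Fin n) ℂ) :=
  (matₗ n).continuous_of_finiteDimensional

/-- The `k`-th diagonal entry of a Hermitian matrix in the basis given by the columns of `U`. -/
def diagEntry (U : Matrix.unitaryGroup (Fin n) ℂ) (A : Herm n) (k : Fin n) : ℝ :=
  ((star (U : Matrix (Fin n) (Fin n) ℂ) * A.mat * U) k k).re

theorem continuous_diagEntry (U : Matrix.unitaryGroup (Fin n) ℂ) (k : Fin n) :
    Continuous fun A => diagEntry U A k := by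
  have h : Continuous fun A : Herm n => star (U : Matrix (Fin n) (Fin n) ℂ) * A.mat * U :=
    (continuous_const.mul continuous_mat).mul continuous_const
  exact Complex.continuous_re.comp (h.matrix_elem k k)

theorem diagEntry_add_smul (U : Matrix.unitaryGroup (Fin n) ℂ) (A B : Herm n) (a b : ℝ)
    (k : Fin n) : diagEntry U (a • A + b • B) k = a * diagEntry U A k + b * diagEntry U B k := by
  simp [diagEntry, mul_add, add_mul]

theorem diagEntry_eigenvectorUnitary (A : Herm n) (k : Fin n) :
    diagEntry A.isHermitian.eigenvectorUnitary A k = A.isHermitian.eigenvalues k := by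
  have h := A.isHermitian.conjStarAlgAut_star_eigenvectorUnitary
  rw [Unitary.conjStarAlgAut_star_apply] at h
  rw [diagEntry]
  erw [h]
  simp

/-- The weights are the squared moduli of the entries of a unitary matrix, hence doubly stochastic.
Column sums make each diagonal entry an average of eigenvalues, as Jensen requires; row sums restore
the full trace in Peierls' inequality. -/
theorem diagEntry_eq_sum (U : Matrix.unitaryGroup (Fin n) ℂ) (A : Herm n) (k : Fin n) :
    diagEntry U A k = ∑ j, Complex.normSq
      ((star A.isHermitian.eigenvectorUnitary * U : Matrix.unitaryGroup (Fin n) ℂ).1 j k) *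
        A.isHermitian.eigenvalues j := by
  set V := A.isHermitian.eigenvectorUnitary with hV
  set W : Matrix.unitaryGroup (Fin n) ℂ := star V * U with hW
  have h1 : A.mat = (V : Matrix (Fin n) (Fin n) ℂ) *
      Matrix.diagonal (RCLike.ofReal ∘ A.isHermitian.eigenvalues) * star (V : Matrix _ _ ℂ) := by
    have := A.isHermitian.spectral_theorem
    rwa [Unitary.conjStarAlgAut_apply] at this
  have h2 : star (U : Matrix (Fin n) (Fin n) ℂ) * A.mat * (U : Matrix (Fin n) (Fin n) ℂ) =
      star (W : Matrix (Fin n) (Fin n) ℂ) *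
        Matrix.diagonal (RCLike.ofReal ∘ A.isHermitian.eigenvalues) * (W : Matrix (Fin n) (Fin n) ℂ) := by
    rw [hW]
    simp only [Submonoid.coe_mul, Unitary.coe_star, star_mul, star_star]
    conv_lhs => rw [h1]
    simp only [mul_assoc]
  rw [diagEntry, h2, Matrix.mul_apply, Complex.re_sum]
  refine Finset.sum_congr rfl fun j _ => ?_
  rw [Matrix.mul_diagonal, Matrix.star_apply, Complex.normSq_apply]
  simp
  ring

theorem sum_normSq_col (W : Matrix.unitaryGroup (Fin n) ℂ) (k : Fin n) :
    ∑ j, Complex.normSq (W.1 j k) = 1 := by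
  have h := congrArg Complex.re (congrFun (congrFun (Unitary.coe_star_mul_self W) k) k)
  rw [Matrix.mul_apply, Complex.re_sum, Matrix.one_apply_eq, Complex.one_re] at h
  rw [← h]
  refine Finset.sum_congr rfl fun j _ => ?_
  simp [Matrix.star_apply, Complex.normSq_apply]

theorem sum_normSq_row (W : Matrix.unitaryGroup (Fin n) ℂ) (j : Fin n) :
    ∑ k, Complex.normSq (W.1 j k) = 1 := by
  have h := congrArg Complex.re (congrFun (congrFun (Unitary.coe_mul_star_self W) j) j)
  rw [Matrix.mul_apply, Complex.re_sum, Matrix.one_apply_eq, Complex.one_re] at h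
  rw [← h]
  refine Finset.sum_congr rfl fun k _ => ?_
  simp [Matrix.star_apply, Complex.normSq_apply]

theorem norm_sq_eq_pairing (A : Herm n) : ‖A‖ ^ 2 = pairing A A := by
  rw [← real_inner_self_eq_norm_sq, inner_def]

end Herm

open Herm

variable {n : ℕ}

theorem regularizer_eq_sum (θ : ℝ → ℝ) (X : Herm n) :
    regularizer θ X = ∑ k, θ (X.isHermitian.eigenvalues k) := by
  rw [regularizer, Matrix.IsHermitian.cfc, Unitary.conjStarAlgAut_apply, Matrix.trace_mul_comm,
    ← mul_assoc, Unitary.coe_star_mul_self, one_mul, Matrix.trace_diagonal, Complex.re_sum]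
  simp

/-- This turns strong convexity in the Frobenius norm into ordinary convexity for the scalar kernel
`θ x - m / 2 * x ^ 2`. -/
theorem regularizer_sq (X : Herm n) : regularizer (fun x => x ^ 2) X = ‖X‖ ^ 2 := by
  have hX : IsSelfAdjoint X.mat := X.isHermitian
  rw [regularizer, ← Matrix.IsHermitian.cfc_eq, cfc_pow_id X.mat 2 hX, norm_sq_eq_pairing, pairing,
    sq]

/-! ### The spectraplex -/

theorem sum_eigenvalues_eq_one {X : Herm n} (hX : X ∈ spectraplex n) :
    ∑ j, X.isHermitian.eigenvalues j = 1 := by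
  simpa [hX.2] using (congrArg Complex.re X.isHermitian.trace_eq_sum_eigenvalues).symm

theorem eigenvalues_mem_Icc {X : Herm n} (hX : X ∈ spectraplex n) (k : Fin n) :
    X.isHermitian.eigenvalues k ∈ Set.Icc (0 : ℝ) 1 := by
  have h0 : ∀ j, 0 ≤ X.isHermitian.eigenvalues j := hX.1.eigenvalues_nonneg
  exact ⟨h0 k, sum_eigenvalues_eq_one hX ▸ Finset.single_le_sum (fun j _ => h0 j) (Finset.mem_univ k)⟩

theorem convex_spectraplex : Convex ℝ (spectraplex n) := by
  intro A hA B hB a b ha hb hab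
  refine ⟨?_, ?_⟩
  · rw [mat_add, mat_smul, mat_smul]
    exact (hA.1.smul ha).add (hB.1.smul hb)
  · rw [mat_add, mat_smul, mat_smul, Matrix.trace_add, Matrix.trace_smul, Matrix.trace_smul, hA.2,
      hB.2, ← add_smul, hab, one_smul]

theorem isClosed_spectraplex : IsClosed (spectraplex n) := by
  have h : spectraplex n = (⋂ x : Fin n → ℂ, {X : Herm n | 0 ≤ star x ⬝ᵥ X.mat.mulVec x}) ∩
      {X : Herm n | X.mat.trace = 1} := by
    ext X
    simp [spectraplex, Matrix.posSemidef_iff_dotProduct_mulVec, X.isHermitian]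
  rw [h]
  refine (isClosed_iInter fun x => ?_).inter
    (isClosed_eq continuous_mat.matrix_trace continuous_const)
  exact isClosed_le continuous_const
    (continuous_const.dotProduct (continuous_mat.matrix_mulVec continuous_const))

theorem norm_le_one_of_mem_spectraplex {X : Herm n} (hX : X ∈ spectraplex n) : ‖X‖ ≤ 1 := by
  have h1 : ‖X‖ ^ 2 ≤ 1 := by
    rw [← regularizer_sq, regularizer_eq_sum]
    rw [← sum_eigenvalues_eq_one hX]
    refine Finset.sum_le_sum fun k _ => ?_
    have := eigenvalues_mem_Icc hX k
    nlinarith [this.1, this.2]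
  nlinarith [norm_nonneg X]

theorem isCompact_spectraplex : IsCompact (spectraplex n) :=
  have : ProperSpace (Herm n) := FiniteDimensional.proper_real _
  Metric.isCompact_of_isClosed_isBounded isClosed_spectraplex
    (Metric.isBounded_closedBall.subset fun _ hX =>
      mem_closedBall_zero_iff.2 (norm_le_one_of_mem_spectraplex hX))

theorem spectraplex_nonempty (hn : 0 < n) : (spectraplex n).Nonempty := by
  have hP : (Matrix.diagonal (Pi.single (⟨0, hn⟩ : Fin n) (1 : ℂ))).PosSemidef :=
    Matrix.PosSemidef.diagonal (Pi.single_nonneg.2 zero_le_one)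
  exact ⟨ofIsHermitian _ hP.isHermitian, hP, by simp [Matrix.trace_diagonal]⟩

/-! ### Convexity of trace functions -/

theorem diagEntry_mem_Icc (U : Matrix.unitaryGroup (Fin n) ℂ) {X : Herm n}
    (hX : X ∈ spectraplex n) (k : Fin n) : diagEntry U X k ∈ Set.Icc (0 : ℝ) 1 := by
  rw [diagEntry_eq_sum]
  exact (convex_Icc (0 : ℝ) 1).sum_mem (fun j _ => Complex.normSq_nonneg _)
    (sum_normSq_col _ k) fun j _ => eigenvalues_mem_Icc hX j

/-- **Peierls' inequality.** -/
theorem sum_diagEntry_le_regularizer {g : ℝ → ℝ} (hg : ConvexOn ℝ (Set.Icc 0 1) g)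
    (U : Matrix.unitaryGroup (Fin n) ℂ) {X : Herm n} (hX : X ∈ spectraplex n) :
    ∑ k, g (diagEntry U X k) ≤ regularizer g X := by
  set W : Matrix.unitaryGroup (Fin n) ℂ := star X.isHermitian.eigenvectorUnitary * U with hW
  calc ∑ k, g (diagEntry U X k)
      ≤ ∑ k, ∑ j, Complex.normSq (W.1 j k) * g (X.isHermitian.eigenvalues j) := by
        refine Finset.sum_le_sum fun k _ => ?_
        rw [diagEntry_eq_sum]
        exact hg.map_sum_le (fun j _ => Complex.normSq_nonneg _) (sum_normSq_col W k)
          fun j _ => eigenvalues_mem_Icc hX j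
    _ = regularizer g X := by
        rw [Finset.sum_comm, regularizer_eq_sum]
        refine Finset.sum_congr rfl fun j _ => ?_
        rw [← Finset.sum_mul, sum_normSq_row, one_mul]

theorem sum_diagEntry_eigenvectorUnitary (g : ℝ → ℝ) (X : Herm n) :
    ∑ k, g (diagEntry X.isHermitian.eigenvectorUnitary X k) = regularizer g X := by
  simp only [diagEntry_eigenvectorUnitary, regularizer_eq_sum]

/-- In an eigenbasis of the convex combination its regularizer is a sum over diagonal entries, which
are linear in the matrix. Scalar convexity splits this sum, and Peierls' inequality bounds each
half. -/
theorem convexOn_regularizer {g : ℝ → ℝ} (hg : ConvexOn ℝ (Set.Icc 0 1) g) :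
    ConvexOn ℝ (spectraplex n) (regularizer g) := by
  refine ⟨convex_spectraplex, fun A hA B hB a b ha hb hab => ?_⟩
  rw [← sum_diagEntry_eigenvectorUnitary g (a • A + b • B)]
  set U := (a • A + b • B).isHermitian.eigenvectorUnitary
  calc ∑ k, g (diagEntry U (a • A + b • B) k)
      ≤ ∑ k, (a * g (diagEntry U A k) + b * g (diagEntry U B k)) := by
        refine Finset.sum_le_sum fun k _ => ?_
        rw [diagEntry_add_smul]
        exact hg.2 (diagEntry_mem_Icc U hA k) (diagEntry_mem_Icc U hB k) ha hb hab
    _ = a * ∑ k, g (diagEntry U A k) + b * ∑ k, g (diagEntry U B k) := by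
        rw [Finset.sum_add_distrib, Finset.mul_sum, Finset.mul_sum]
    _ ≤ a • regularizer g A + b • regularizer g B := by
        rw [smul_eq_mul, smul_eq_mul]
        gcongr
        · exact sum_diagEntry_le_regularizer hg U hA
        · exact sum_diagEntry_le_regularizer hg U hB

/-- Derivatives matter only in the open interval; continuity covers the endpoints, so `θ'` may blow
up at `0`. -/
theorem convexOn_kernel_sub_sq {θ : ℝ → ℝ} (hθ : IsRegularizerKernel θ) {m : ℝ}
    (hm : ∀ x ∈ Set.Ioc (0 : ℝ) 1,
      m ≤ derivWithin (derivWithin θ (Set.Ioc 0 1)) (Set.Ioc 0 1) x) :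
    ConvexOn ℝ (Set.Icc 0 1) fun x => θ x - m / 2 * x ^ 2 := by
  have hnhds : ∀ x ∈ interior (Set.Icc (0 : ℝ) 1), Set.Ioc (0 : ℝ) 1 ∈ 𝓝 x := fun x hx => by
    rw [interior_Icc] at hx
    exact Ioc_mem_nhds hx.1 hx.2
  refine convexOn_of_hasDerivWithinAt2_nonneg (convex_Icc 0 1)
    (f' := fun x => derivWithin θ (Set.Ioc 0 1) x - m * x)
    (f'' := fun x => derivWithin (derivWithin θ (Set.Ioc 0 1)) (Set.Ioc 0 1) x - m)
    (hθ.continuousOn.sub (by fun_prop)) (fun x hx => ?_) (fun x hx => ?_) fun x hx => ?_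
  · have h1 := ((hθ.differentiableOn x (mem_of_mem_nhds (hnhds x hx))).hasDerivWithinAt).hasDerivAt
      (hnhds x hx)
    have h2 := ((hasDerivAt_pow 2 x).const_mul (m / 2))
    refine ((h1.fun_sub h2).congr_deriv ?_).hasDerivWithinAt
    norm_num
    ring
  · have h1 := ((hθ.differentiableOn_deriv x
      (mem_of_mem_nhds (hnhds x hx))).hasDerivWithinAt).hasDerivAt (hnhds x hx)
    have h2 := (hasDerivAt_id x).const_mul m
    refine ((h1.fun_sub h2).congr_deriv ?_).hasDerivWithinAt
    simp
  · exact sub_nonneg.2 (hm x (mem_of_mem_nhds (hnhds x hx)))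

theorem regularizer_sub_sq (θ : ℝ → ℝ) (m : ℝ) (X : Herm n) :
    regularizer (fun x => θ x - m / 2 * x ^ 2) X = regularizer θ X - m / 2 * ‖X‖ ^ 2 := by
  rw [← regularizer_sq]
  simp only [regularizer_eq_sum, Finset.sum_sub_distrib, Finset.mul_sum]

/-- Regularizers are strongly convex with respect to the Frobenius norm. -/
theorem strongConvexOn_regularizer {θ : ℝ → ℝ} (hθ : IsRegularizerKernel θ) :
    ∃ m : ℝ, 0 < m ∧ ∀ n, StrongConvexOn (spectraplex n) m (regularizer θ) := by
  obtain ⟨m, hm0, hm⟩ := hθ.second_deriv_lower_bound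
  refine ⟨m, hm0, fun n => strongConvexOn_iff_convex.2 ?_⟩
  rw [← funext (regularizer_sub_sq θ m)]
  exact convexOn_regularizer (convexOn_kernel_sub_sq hθ hm)

theorem convexOn_kernel {θ : ℝ → ℝ} (hθ : IsRegularizerKernel θ) :
    ConvexOn ℝ (Set.Icc 0 1) θ := by
  obtain ⟨m, hm0, hm⟩ := hθ.second_deriv_lower_bound
  simpa using convexOn_kernel_sub_sq hθ (m := 0) fun x hx => hm0.le.trans (hm x hx)

/-! ### Regularized best responses -/

theorem pairing_eq_inner (A B : Herm n) : A.pairing B = inner ℝ A B := rfl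

/-- In a fixed eigenbasis of `X`, the sum over diagonal entries is continuous, lies below the
regularizer by Peierls' inequality, and touches it at `X`. This avoids continuity of eigenvalues and
is enough for a minimizer to exist. -/
theorem lowerSemicontinuousOn_regularizer_sub {θ : ℝ → ℝ} (hθ : IsRegularizerKernel θ)
    (Y : Herm n) :
    LowerSemicontinuousOn (fun X => regularizer θ X - Y.pairing X) (spectraplex n) := by
  intro X hX r hr
  set U := X.isHermitian.eigenvectorUnitary with hU
  have hcont : ContinuousOn (fun A => ∑ k, θ (diagEntry U A k) - Y.pairing A) (spectraplex n) := by
    refine ContinuousOn.sub (continuousOn_finsetSum _ fun k _ => ?_) ?_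
    · exact hθ.continuousOn.comp (continuous_diagEntry U k).continuousOn
        fun A hA => diagEntry_mem_Icc U hA k
    · exact (Continuous.inner (𝕜 := ℝ) continuous_const continuous_id).continuousOn
  have hr' : r < ∑ k, θ (diagEntry U X k) - Y.pairing X := by
    rwa [sum_diagEntry_eigenvectorUnitary]
  filter_upwards [(hcont X hX).eventually_const_lt hr', self_mem_nhdsWithin] with A h1 h2
  exact h1.trans_le (sub_le_sub_right (sum_diagEntry_le_regularizer (convexOn_kernel hθ) U h2) _)

theorem regularizedBestResponse_nonempty {θ : ℝ → ℝ} (hθ : IsRegularizerKernel θ) (hn : 0 < n)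
    (Y : Herm n) : (regularizedBestResponse θ Y).Nonempty := by
  obtain ⟨X, hX, hmin⟩ := (lowerSemicontinuousOn_regularizer_sub hθ Y).exists_isMinOn
    (spectraplex_nonempty hn) isCompact_spectraplex
  refine ⟨X, hX, fun X' hX' => ?_⟩
  have : regularizer θ X - Y.pairing X ≤ regularizer θ X' - Y.pairing X' := hmin hX'
  linarith

/-- Regularized best responses depend Lipschitz continuously on the payoff matrix. -/
theorem norm_bestResponse_sub_le {θ : ℝ → ℝ} {m : ℝ} (hm : 0 < m)
    (hθ : StrongConvexOn (spectraplex n) m (regularizer θ)) {Y Y' X X' : Herm n}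
    (hX : X ∈ regularizedBestResponse θ Y) (hX' : X' ∈ regularizedBestResponse θ Y') :
    ‖X - X'‖ ≤ 2 / m * ‖Y - Y'‖ := by
  -- Both optimality conditions are tested at the midpoint; adding them leaves the strong convexity
  -- gain against `⟪Y - Y', X - X'⟫`.
  have hmid := hθ.2 hX.1 hX'.1 (show (0 : ℝ) ≤ 1 / 2 by norm_num)
    (show (0 : ℝ) ≤ 1 / 2 by norm_num) (by norm_num)
  have hZ := convex_spectraplex hX.1 hX'.1 (a := 1 / 2) (b := 1 / 2) (by norm_num) (by norm_num)
    (by norm_num)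
  have h1 := hX.2 _ hZ
  have h2 := hX'.2 _ hZ
  simp only [pairing_eq_inner, inner_add_right, inner_smul_right, smul_eq_mul] at hmid h1 h2
  have h3 : m / 2 * ‖X - X'‖ ^ 2 ≤ inner ℝ (Y - Y') (X - X') := by
    simp only [inner_sub_left, inner_sub_right]
    linarith
  have h4 := h3.trans (real_inner_le_norm (Y - Y') (X - X'))
  rcases (norm_nonneg (X - X')).eq_or_lt with h0 | h0
  · rw [← h0]
    positivity
  · rw [div_mul_eq_mul_div, le_div_iff₀ hm]
    have h5 : m / 2 * ‖X - X'‖ ≤ ‖Y - Y'‖ := le_of_mul_le_mul_right (by linarith) h0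
    linarith

end QuantumFTQL

namespace QuantumFTQL

/-! ### Payoff gradients -/

section Payoff

variable {ι : Type*} [Fintype ι] [DecidableEq ι] {d : ι → ℕ} {Ω : Type*} [Fintype Ω]

theorem productMatrix_update (X : ∀ i, Herm (d i)) (i : ι) (H : Herm (d i)) (k l : ∀ i, Fin (d i)) :
    productMatrix (Function.update X i H) k l =
      H.mat (k i) (l i) * ∏ j ∈ Finset.univ.erase i, (X j).mat (k j) (l j) := by
  rw [productMatrix, Matrix.of_apply, ← Finset.mul_prod_erase _ _ (Finset.mem_univ i),
    Function.update_self]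
  congr 1
  refine Finset.prod_congr rfl fun j hj => ?_
  rw [Function.update_of_ne (Finset.ne_of_mem_erase hj)]

/-- The payoff of player `i` as a linear function of the matrix of player `i`. -/
noncomputable def ownPayoff (G : QuantumGame d Ω) (X : ∀ i, Herm (d i)) (i : ι) :
    Herm (d i) →ₗ[ℝ] ℝ where
  toFun H := mixedPayoff G i (Function.update X i H)
  map_add' A B := by
    have h : productMatrix (Function.update X i (A + B)) =
        productMatrix (Function.update X i A) + productMatrix (Function.update X i B) := by
      ext k l
      simp [productMatrix_update, add_mul]
    simp [mixedPayoff, h, mul_add, add_mul, Finset.sum_add_distrib]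
  map_smul' r A := by
    have h : productMatrix (Function.update X i (r • A)) =
        r • productMatrix (Function.update X i A) := by
      ext k l
      simp [productMatrix_update, mul_assoc]
    simp [mixedPayoff, h, mul_assoc, Finset.mul_sum]

theorem inner_payoffGradient (G : QuantumGame d Ω) (X : ∀ i, Herm (d i)) (i : ι) (H : Herm (d i)) :
    inner ℝ (payoffGradient G X i) H = mixedPayoff G i (Function.update X i H) := by
  have h := (ownPayoff G X i).toContinuousLinearMap.hasFDerivAt (x := X i)
  have h' : fderiv ℝ (fun H : Herm (d i) => mixedPayoff G i (Function.update X i H)) (X i) =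
      (ownPayoff G X i).toContinuousLinearMap := h.fderiv
  rw [payoffGradient, gradient, h', InnerProductSpace.toDual_symm_apply]
  rfl

/-- The payoff is linear in the player's own slot, so its gradient represents that linear form and
cannot see the point of evaluation. This is the source of zero divergence. -/
theorem payoffGradient_update (G : QuantumGame d Ω) (X : ∀ i, Herm (d i)) (i : ι) (A : Herm (d i)) :
    payoffGradient G (Function.update X i A) i = payoffGradient G X i := by
  refine ext_inner_right ℝ fun H => ?_
  rw [inner_payoffGradient, inner_payoffGradient, Function.update_idem]

theorem contDiff_mixedPayoff (G : QuantumGame d Ω) (i : ι) : ContDiff ℝ 1 (mixedPayoff G i) := by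
  have hentry : ∀ (j : ι) (a b : Fin (d j)),
      ContDiff ℝ 1 fun X : ∀ i, Herm (d i) => (X j).mat a b := fun j a b => by
    let e : Herm (d j) →ₗ[ℝ] ℂ :=
      { toFun := fun A => A.mat a b, map_add' := fun _ _ => rfl, map_smul' := fun _ _ => rfl }
    exact e.toContinuousLinearMap.contDiff.comp
      (ContinuousLinearMap.proj (R := ℝ) (φ := fun i => Herm (d i)) j).contDiff
  unfold mixedPayoff
  simp only [Matrix.trace, Matrix.diag, Matrix.mul_apply, productMatrix, Matrix.of_apply]
  refine ContDiff.sum fun ω _ => ContDiff.mul (Complex.reCLM.contDiff.comp ?_) contDiff_const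
  exact ContDiff.sum fun k _ => ContDiff.sum fun l _ =>
    contDiff_const.mul (contDiff_prod fun j _ => hentry j _ _)

theorem contDiff_payoffGradient (G : QuantumGame d Ω) : ContDiff ℝ 1 (payoffGradient G) := by
  refine contDiff_pi.2 fun i => ?_
  -- In an orthonormal basis the coordinates of the gradient are payoffs with a fixed matrix in slot
  -- `i`, hence smooth in the profile.
  have h : (fun X => payoffGradient G X i) = fun X => ∑ a,
      mixedPayoff G i (Function.update X i (stdOrthonormalBasis ℝ (Herm (d i)) a)) •
        stdOrthonormalBasis ℝ (Herm (d i)) a := by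
    funext X
    conv_lhs => rw [← (stdOrthonormalBasis ℝ (Herm (d i))).sum_repr' (payoffGradient G X i)]
    simp only [real_inner_comm, inner_payoffGradient]
  rw [h]
  refine ContDiff.sum fun a _ => ContDiff.smul ((contDiff_mixedPayoff G i).comp ?_) contDiff_const
  refine contDiff_pi.2 fun j => ?_
  rcases eq_or_ne j i with rfl | hj
  · simpa using contDiff_const
  · simp only [Function.update_of_ne hj]
    exact (ContinuousLinearMap.proj (R := ℝ) (φ := fun i => Herm (d i)) j).contDiff

theorem payoffGradient_lipschitzOn_bounded (G : QuantumGame d Ω) :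
    ∃ K M : NNReal,
      LipschitzOnWith K (payoffGradient G) (Set.univ.pi fun i => spectraplex (d i)) ∧
      ∀ X ∈ Set.univ.pi fun i => spectraplex (d i), ‖payoffGradient G X‖ ≤ M := by
  have hc : IsCompact (Set.univ.pi fun i => spectraplex (d i)) :=
    isCompact_univ_pi fun i => isCompact_spectraplex
  obtain ⟨K, hK⟩ := (contDiff_payoffGradient G).contDiffOn.exists_lipschitzOnWith one_ne_zero
    (convex_pi fun i _ => convex_spectraplex (n := d i)) hc
  obtain ⟨M, hM⟩ := hc.exists_bound_of_continuousOn
    (contDiff_payoffGradient G).continuous.continuousOn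
  exact ⟨K, M.toNNReal, hK, fun X hX => (hM X hX).trans (Real.le_coe_toNNReal M)⟩

end Payoff

/-! ### The FTQL vector field -/

section VectorField

variable {n : ℕ}

open Classical in
/-- A regularized best response to `Y`. -/
noncomputable def bestResponse (θ : ℝ → ℝ) (Y : Herm n) : Herm n :=
  if h : (regularizedBestResponse θ Y).Nonempty then h.some else 0

theorem bestResponse_mem {θ : ℝ → ℝ} (hθ : IsRegularizerKernel θ) (hn : 0 < n) (Y : Herm n) :
    bestResponse θ Y ∈ regularizedBestResponse θ Y := by
  have h := regularizedBestResponse_nonempty hθ hn Y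
  rw [bestResponse, dif_pos h]
  exact h.some_mem

theorem eq_bestResponse {θ : ℝ → ℝ} (hθ : IsRegularizerKernel θ) (hn : 0 < n) {X Y : Herm n}
    (hX : X ∈ regularizedBestResponse θ Y) : X = bestResponse θ Y := by
  obtain ⟨m, hm, h⟩ := strongConvexOn_regularizer hθ
  -- The Lipschitz estimate with equal payoff matrices is uniqueness.
  have := norm_bestResponse_sub_le hm (h n) hX (bestResponse_mem hθ hn Y)
  rw [sub_self, norm_zero, mul_zero] at this
  exact sub_eq_zero.1 (norm_le_zero_iff.1 this)

theorem lipschitzWith_bestResponse {θ : ℝ → ℝ} (hθ : IsRegularizerKernel θ) (hn : 0 < n) :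
    ∃ L : NNReal, LipschitzWith L (bestResponse θ : Herm n → Herm n) := by
  obtain ⟨m, hm, h⟩ := strongConvexOn_regularizer hθ
  refine ⟨⟨2 / m, by positivity⟩, LipschitzWith.of_dist_le_mul fun Y Y' => ?_⟩
  rw [dist_eq_norm, dist_eq_norm]
  exact norm_bestResponse_sub_le hm (h n) (bestResponse_mem hθ hn Y) (bestResponse_mem hθ hn Y')

variable {ι : Type*} [Fintype ι] [DecidableEq ι] {d : ι → ℕ} {Ω : Type*} [Fintype Ω]

/-- The vector field of the FTQL dynamics. -/
noncomputable def ftqlField (G : QuantumGame d Ω) (θ : ι → ℝ → ℝ) (Y : ∀ i, Herm (d i)) :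
    ∀ i, Herm (d i) :=
  payoffGradient G fun j => bestResponse (θ j) (Y j)

theorem ftqlField_lipschitz_bounded (hd : ∀ i, 0 < d i) (G : QuantumGame d Ω) {θ : ι → ℝ → ℝ}
    (hθ : ∀ i, IsRegularizerKernel (θ i)) :
    ∃ K M : NNReal, LipschitzWith K (ftqlField G θ) ∧ ∀ Y, ‖ftqlField G θ Y‖ ≤ M := by
  obtain ⟨K, M, hK, hM⟩ := payoffGradient_lipschitzOn_bounded G
  choose L hL using fun i => lipschitzWith_bestResponse (hθ i) (hd i)
  have hmem : ∀ Y : ∀ i, Herm (d i), (fun j => bestResponse (θ j) (Y j)) ∈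
      Set.univ.pi fun i => spectraplex (d i) := fun Y j _ =>
    (bestResponse_mem (hθ j) (hd j) (Y j)).1
  have hQ : LipschitzWith (∑ i, L i)
      fun (Y : ∀ i, Herm (d i)) j => bestResponse (θ j) (Y j) := by
    refine LipschitzWith.of_dist_le_mul fun Y Y' =>
      (dist_pi_le_iff (by positivity)).2 fun j => ((hL j).dist_le_mul _ _).trans ?_
    gcongr
    · exact_mod_cast Finset.single_le_sum (f := L) (fun i _ => zero_le) (Finset.mem_univ j)
    · exact dist_le_pi_dist Y Y' j
  refine ⟨K * ∑ i, L i, M, ?_, fun Y => hM _ (hmem Y)⟩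
  exact lipschitzOnWith_univ.1 (hK.comp hQ.lipschitzOnWith fun Y _ => hmem Y)

theorem ftqlField_update (G : QuantumGame d Ω) (θ : ι → ℝ → ℝ) (i : ι) (Y : ∀ i, Herm (d i))
    (A : Herm (d i)) : ftqlField G θ (Function.update Y i A) i = ftqlField G θ Y i := by
  have h : (fun j => bestResponse (θ j) (Function.update Y i A j)) =
      Function.update (fun j => bestResponse (θ j) (Y j)) i (bestResponse (θ i) A) := by
    ext1 j
    rcases eq_or_ne j i with rfl | hj <;> simp [*]
  rw [ftqlField, h, payoffGradient_update, ftqlField]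

theorem isFTQLSolution_iff (hd : ∀ i, 0 < d i) (G : QuantumGame d Ω) {θ : ι → ℝ → ℝ}
    (hθ : ∀ i, IsRegularizerKernel (θ i)) (Y : ℝ → ∀ i, Herm (d i)) :
    IsFTQLSolution G θ Y ↔ ∀ t, HasDerivAt Y (ftqlField G θ (Y t)) t := by
  refine ⟨fun ⟨X, hX, hY⟩ t => ?_, fun h =>
    ⟨fun t i => bestResponse (θ i) (Y t i), fun t i => bestResponse_mem (hθ i) (hd i) _, h⟩⟩
  have : X t = fun i => bestResponse (θ i) (Y t i) :=
    funext fun i => eq_bestResponse (hθ i) (hd i) (hX t i)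
  rw [ftqlField, ← this]
  exact hY t

end VectorField

/-! ### The traceless quotient -/

section Traceless

variable {n : ℕ}

/-- The projection onto traceless matrices, as a continuous linear map. -/
noncomputable def removeTraceL (n : ℕ) : Herm n →L[ℝ] Traceless n :=
  LinearMap.toContinuousLinearMap
    { toFun := removeTrace
      map_add' := fun A B => by
        refine Subtype.ext (Herm.ext ?_)
        change (A + B).mat - ((A + B).tr / n) • (1 : Matrix (Fin n) (Fin n) ℂ) =
          (A.mat - (A.tr / n) • (1 : Matrix (Fin n) (Fin n) ℂ)) +
            (B.mat - (B.tr / n) • (1 : Matrix (Fin n) (Fin n) ℂ))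
        simp only [Herm.mat_add, Herm.tr, Matrix.trace_add, Complex.add_re, add_div, add_smul]
        abel
      map_smul' := fun r A => by
        refine Subtype.ext (Herm.ext ?_)
        change (r • A).mat - ((r • A).tr / n) • (1 : Matrix (Fin n) (Fin n) ℂ) =
          r • (A.mat - (A.tr / n) • (1 : Matrix (Fin n) (Fin n) ℂ))
        simp only [Herm.mat_smul, Herm.tr, Matrix.trace_smul, Complex.smul_re, smul_eq_mul,
          smul_sub, smul_smul, mul_div_assoc] }

/-- The inclusion of traceless matrices, as a continuous linear map. -/
noncomputable def toHermL (n : ℕ) : Traceless n →L[ℝ] Herm n :=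
  LinearMap.toContinuousLinearMap
    { toFun := Traceless.toHerm, map_add' := fun _ _ => rfl, map_smul' := fun _ _ => rfl }

theorem pairing_removeTrace (Y : Herm n) {X : Herm n} (hX : X ∈ spectraplex n) :
    (removeTrace Y).toHerm.pairing X = Y.pairing X - Y.tr / n := by
  change ((Y.mat - (Y.tr / n) • (1 : Matrix (Fin n) (Fin n) ℂ)) * X.mat).trace.re = _
  rw [sub_mul, smul_mul_assoc, one_mul, Matrix.trace_sub, Matrix.trace_smul, hX.2]
  simp [Herm.pairing]

/-- Regularized best responses only depend on the traceless part of the payoff matrix. -/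
theorem regularizedBestResponse_removeTrace (θ : ℝ → ℝ) (Y : Herm n) :
    regularizedBestResponse θ (removeTrace Y).toHerm = regularizedBestResponse θ Y := by
  ext X
  refine and_congr_right fun hX => forall₂_congr fun X' hX' => ?_
  rw [pairing_removeTrace Y hX, pairing_removeTrace Y hX', sub_right_comm, sub_right_comm _ (_ / _),
    sub_le_sub_iff_right]

-- The chosen maximizer depends only on the set of maximizers, so equality of these sets suffices.
open Classical in
theorem bestResponse_removeTrace (θ : ℝ → ℝ) (Y : Herm n) :
    bestResponse θ (removeTrace Y).toHerm = bestResponse θ Y :=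
  congrArg (fun S : Set (Herm n) => if h : S.Nonempty then h.some else 0)
    (regularizedBestResponse_removeTrace θ Y)

variable {ι : Type*} [Fintype ι] [DecidableEq ι] {d : ι → ℕ} {Ω : Type*} [Fintype Ω]

/-- The projection of profiles onto traceless profiles. -/
noncomputable def removeTracePi (d : ι → ℕ) : (∀ i, Herm (d i)) →L[ℝ] ∀ i, Traceless (d i) :=
  ContinuousLinearMap.piMap fun i => removeTraceL (d i)

/-- The inclusion of traceless profiles. -/
noncomputable def toHermPi (d : ι → ℕ) : (∀ i, Traceless (d i)) →L[ℝ] ∀ i, Herm (d i) :=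
  ContinuousLinearMap.piMap fun i => toHermL (d i)

/-- The vector field of the FTQL dynamics on traceless matrices. -/
noncomputable def tracelessField (G : QuantumGame d Ω) (θ : ι → ℝ → ℝ)
    (Z : ∀ i, Traceless (d i)) : ∀ i, Traceless (d i) :=
  removeTracePi d (ftqlField G θ (toHermPi d Z))

theorem tracelessField_lipschitz_bounded (hd : ∀ i, 0 < d i) (G : QuantumGame d Ω)
    {θ : ι → ℝ → ℝ} (hθ : ∀ i, IsRegularizerKernel (θ i)) :
    ∃ K M : NNReal, LipschitzWith K (tracelessField G θ) ∧ ∀ Z, ‖tracelessField G θ Z‖ ≤ M := by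
  obtain ⟨K, M, hK, hM⟩ := ftqlField_lipschitz_bounded hd G hθ
  refine ⟨‖removeTracePi d‖₊ * (K * ‖toHermPi d‖₊), ‖removeTracePi d‖₊ * M,
    (removeTracePi d).lipschitz.comp (hK.comp (toHermPi d).lipschitz), fun Z => ?_⟩
  refine ((removeTracePi d).le_opNorm _).trans ?_
  rw [NNReal.coe_mul, coe_nnnorm]
  gcongr
  exact hM _

theorem tracelessField_update (G : QuantumGame d Ω) (θ : ι → ℝ → ℝ) (i : ι)
    (Z : ∀ i, Traceless (d i)) (A : Traceless (d i)) :
    tracelessField G θ (Function.update Z i A) i = tracelessField G θ Z i := by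
  have h : toHermPi d (Function.update Z i A) = Function.update (toHermPi d Z) i A.toHerm := by
    ext1 j
    rcases eq_or_ne j i with rfl | hj
    · rw [Function.update_self]
      exact congrArg Traceless.toHerm (Function.update_self _ _ _)
    · rw [Function.update_of_ne hj]
      exact congrArg Traceless.toHerm (Function.update_of_ne hj _ _)
  rw [tracelessField, h]
  exact congrArg removeTrace (ftqlField_update G θ i _ _)

theorem isTracelessFTQLSolution_iff (hd : ∀ i, 0 < d i) (G : QuantumGame d Ω) {θ : ι → ℝ → ℝ}
    (hθ : ∀ i, IsRegularizerKernel (θ i)) (Z : ℝ → ∀ i, Traceless (d i)) :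
    IsTracelessFTQLSolution G θ Z ↔ ∀ t, HasDerivAt Z (tracelessField G θ (Z t)) t := by
  refine ⟨fun ⟨X, hX, hZ⟩ t => ?_, fun h =>
    ⟨fun t i => bestResponse (θ i) (Z t i).toHerm, fun t i => bestResponse_mem (hθ i) (hd i) _, h⟩⟩
  have : X t = fun i => bestResponse (θ i) (Z t i).toHerm :=
    funext fun i => eq_bestResponse (hθ i) (hd i) (hX t i)
  have hZt := hZ t
  rw [this] at hZt
  exact hZt

theorem tracelessField_removeTracePi (G : QuantumGame d Ω) (θ : ι → ℝ → ℝ)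
    (Y : ∀ i, Herm (d i)) :
    tracelessField G θ (removeTracePi d Y) = removeTracePi d (ftqlField G θ Y) := by
  have h : (fun j => bestResponse (θ j) (toHermPi d (removeTracePi d Y) j)) =
      fun j => bestResponse (θ j) (Y j) :=
    funext fun j => bestResponse_removeTrace (θ j) (Y j)
  rw [tracelessField, ftqlField, h, ftqlField]

end Traceless

/-! ### Images of open sets and the main theorem -/

theorem volume_image_flow {X : Type*} [TopologicalSpace X] [MeasureSpace X] [BorelSpace X]
    (φ : Flow ℝ X) {t : ℝ} (ht : MeasurePreserving (φ t) (volume : Measure X) volume) {U : Set X}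
    (hU : IsOpen U) : volume (φ t '' U) = volume U := by
  have hopen : IsOpen (φ t '' U) := (φ.toHomeomorph t).isOpenMap U hU
  rw [← ht.measure_preimage hopen.measurableSet.nullMeasurableSet,
    Set.preimage_image_eq _ (show Function.Injective (φ t) from (φ.toHomeomorph t).injective)]

end QuantumFTQL

open QuantumFTQL MeasureTheory
theorem mainTheorem5 {ι : Type*} [Fintype ι] [DecidableEq ι] (d : ι → ℕ) (hd : ∀ i, 0 < d i)
    {Ω : Type*} [Fintype Ω] (G : QuantumGame d Ω)
    (θ : ι → ℝ → ℝ) (hθ : ∀ i, IsRegularizerKernel (θ i)) :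
    (∃! φ : Flow ℝ (∀ i, Herm (d i)),
      IsFlowOf φ (IsFTQLSolution G θ)) ∧
    (∃! ζ : Flow ℝ (∀ i, Traceless (d i)),
      IsFlowOf ζ (IsTracelessFTQLSolution G θ)) ∧
    ∀ (φ : Flow ℝ (∀ i, Herm (d i))) (ζ : Flow ℝ (∀ i, Traceless (d i))),
      IsFlowOf φ (IsFTQLSolution G θ) →
      IsFlowOf ζ (IsTracelessFTQLSolution G θ) →
      (∀ (t : ℝ) (Y : ∀ i, Herm (d i)),
        ζ t (fun i => removeTrace (Y i)) =
          fun i => removeTrace (φ t Y i)) ∧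
      (∀ U : Set (∀ i, Herm (d i)), IsOpen U → ∀ t : ℝ, 0 ≤ t →
        volume (φ t '' U) = volume U) ∧
      (∀ W : Set (∀ i, Traceless (d i)), IsOpen W → ∀ t : ℝ, 0 ≤ t →
        volume (ζ t '' W) = volume W) := by
  obtain ⟨K, M, hK, hM⟩ := ftqlField_lipschitz_bounded hd G hθ
  obtain ⟨K', M', hK', hM'⟩ := tracelessField_lipschitz_bounded hd G hθ
  have hsol : IsFTQLSolution G θ = fun Y => ∀ t, HasDerivAt Y (ftqlField G θ (Y t)) t :=
    funext fun Y => propext (isFTQLSolution_iff hd G hθ Y)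
  have hsol' : IsTracelessFTQLSolution G θ =
      fun Z => ∀ t, HasDerivAt Z (tracelessField G θ (Z t)) t :=
    funext fun Z => propext (isTracelessFTQLSolution_iff hd G hθ Z)
  rw [hsol, hsol']
  obtain ⟨φ₀, hφ₀⟩ := exists_flow hK hM
  obtain ⟨ζ₀, hζ₀⟩ := exists_flow hK' hM'
  refine ⟨⟨φ₀, hφ₀, fun φ hφ => hφ.unique hφ₀⟩, ⟨ζ₀, hζ₀, fun ζ hζ => hζ.unique hζ₀⟩,
    fun φ ζ hφ hζ => ⟨fun t Y => ?_, fun U hU t ht => ?_, fun W hW t ht => ?_⟩⟩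
  -- The projected orbit solves the traceless system, so uniqueness identifies it with the orbit of
  -- `ζ`.
  · have h : ∀ t, HasDerivAt (fun t => removeTracePi d (φ t Y))
        (tracelessField G θ (removeTracePi d (φ t Y))) t := fun t => by
      rw [tracelessField_removeTracePi]
      exact (removeTracePi d).hasFDerivAt.comp_hasDerivAt t (hφ.isSolution Y t)
    have h' := (hζ _).1 h t
    simp only [Flow.map_zero_apply] at h'
    exact h'.symm
  · exact volume_image_flow φ (measurePreserving_flow hK hM (ftqlField_update G θ) hφ ht) hU
  · exact volume_image_flow ζ (measurePreserving_flow hK' hM' (tracelessField_update G θ) hζ ht) hW
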